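/- Let $H, E, E', Z$ be real Hilbert spaces (possibly infinite-dimensional), let $\Lambda : H \to \mathbb{R}^m$ be a surjective bounded linear map with null space $\mathcal{N} := \ker \Lambda$, and let $R : H \to E$, $S : H \to E'$, $Q : H \to Z$ be bounded linear maps. Assume that $\ker R \cap \ker S \cap \ker \Lambda = \{0\}$. Let $R_{\mathcal N}, S_{\mathcal N}, Q_{\mathcal N}$ denote the restrictions of $R, S, Q$ to $\mathcal{N}$, with adjoints $R_{\mathcal N}^*, S_{\mathcal N}^*, Q_{\mathcal N}^*$ taking values in $\mathcal{N}$, and write $A \succeq B$ when $A - B$ is positive semidefinite. Then, in the extended real line (with $\inf\emptyset = +\infty$), $$ \sup_{h \in \mathcal{N}} \big\{ \|Qh\|^2 : \ \|Rh\|^2 \le 1,\ \|Sh\|^2 \le 1 \big\} = \inf_{a,b \ge 0} \big\{ a+b : \ a R_{\mathcal N}^* R_{\mathcal N} + b S_{\mathcal N}^* S_{\mathcal N} \succeq Q_{\mathcal N}^* Q_{\mathcal N} \big\}. $$ Moreover, if $h_\sharp \in \mathcal{N}$ is a maximizer of the left-hand program and $(a_\sharp, b_\sharp)$, with $a_\sharp,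 b_\sharp > 0$, is a minimizer of the right-hand program, then (i) $\|R h_\sharp\| = 1$ and $\|S h_\sharp\| = 1$; (ii) $\big( a_\sharp R_{\mathcal N}^* R_{\mathcal N} + b_\sharp S_{\mathcal N}^* S_{\mathcal N} \big) h_\sharp = Q_{\mathcal N}^* Q_{\mathcal N} h_\sharp$. -/

import Mathlib

noncomputable section

namespace TwoEllipsoid

variable {H Y E E' Z : Type*}
  [NormedAddCommGroup H] [InnerProductSpace ℝ H] [CompleteSpace H]
  [NormedAddCommGroup Y] [InnerProductSpace ℝ Y]
  [NormedAddCommGroup E] [InnerProductSpace ℝ E] [CompleteSpace E]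
  [NormedAddCommGroup E'] [InnerProductSpace ℝ E'] [CompleteSpace E']
  [NormedAddCommGroup Z] [InnerProductSpace ℝ Z] [CompleteSpace Z]

/-- The null space `𝒩 = ker Λ` of the observation map, as a (closed) subspace of `H`. -/
abbrev nullSpace (L : H →L[ℝ] Y) : Submodule ℝ H := LinearMap.ker (L : H →ₗ[ℝ] Y)

instance (L : H →L[ℝ] Y) : CompleteSpace (nullSpace L) :=
  L.isClosed_ker.completeSpace_coe

/-- The restriction `T_𝒩 : 𝒩 → E` of `T : H → E` to the null space `𝒩 = ker Λ`. -/
def restrictNull (L : H →L[ℝ] Y) (T : H →L[ℝ] E) : nullSpace L →L[ℝ] E :=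
  T ∘L (nullSpace L).subtypeL

/-- The operator `T_𝒩* T_𝒩 : 𝒩 → 𝒩`, where `T_𝒩` is the restriction of `T` to `𝒩 = ker Λ`. -/
def gramNull (L : H →L[ℝ] Y) (T : H →L[ℝ] E) : nullSpace L →L[ℝ] nullSpace L :=
  (restrictNull L T).adjoint ∘L restrictNull L T

/-- The feasible set `{h ∈ 𝒩 : ‖R h‖² ≤ 1, ‖S h‖² ≤ 1}` of the maximization program. -/
def primalFeasible (L : H →L[ℝ] Y) (R : H →L[ℝ] E) (S : H →L[ℝ] E') : Set (nullSpace L) :=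
  {h | ‖R h‖ ^ 2 ≤ 1 ∧ ‖S h‖ ^ 2 ≤ 1}

/-- The feasible set `{(a, b) : a, b ≥ 0, a R_𝒩* R_𝒩 + b S_𝒩* S_𝒩 ⪰ Q_𝒩* Q_𝒩}` of the
minimization program; `≤` between operators is the Loewner order. -/
def dualFeasible (L : H →L[ℝ] Y) (R : H →L[ℝ] E) (S : H →L[ℝ] E') (Q : H →L[ℝ] Z) :
    Set (ℝ × ℝ) :=
  {p | 0 ≤ p.1 ∧ 0 ≤ p.2 ∧ gramNull L Q ≤ p.1 • gramNull L R + p.2 • gramNull L S}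

end TwoEllipsoid

end

/-!
The inequality `≤` between the two programs is weak duality: if `a R* R + b S* S ⪰ Q* Q`, then
`‖Q h‖² ≤ a ‖R h‖² + b ‖S h‖² ≤ a + b` at every feasible `h`.

The reverse inequality is a statement about quadratic forms on an arbitrary real vector space, so
that neither compactness nor coercivity is needed. If the supremum is a finite number `c`, then by
homogeneity `‖Q x‖² ≤ c max (‖R x‖², ‖S x‖²)` for all `x ∈ 𝒩`; that is, the quadratic forms
`f = ‖Q ·‖² - c ‖R ·‖²` and `g = ‖Q ·‖² - c ‖S ·‖²` are never positive at the same point. Yuan's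
lemma (`QuadraticMap.exists_convexCombination_nonpos`) provides `t ∈ [0, 1]` such that
`t f + (1 - t) g ≤ 0` everywhere, so `(t c, (1 - t) c)` is dual feasible with value `c`
(`exists_multipliers`). Yuan's lemma itself results from using twice that an interval is connected:
in the parameter `t`, and along a segment joining two vectors.

For the optimality conditions, strong duality gives `‖Q h‖² = a + b`, so that both inequalities of
weak duality are equalities at `h`. As `a, b > 0`, this forces `‖R h‖ = ‖S h‖ = 1`, and the positive
operator `a R* R + b S* S - Q* Q` has vanishing quadratic form at `h`, hence annihilates `h`.
-/

open Set
open scoped InnerProductSpace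

/-! ### Yuan's lemma on two quadratic forms -/

section Yuan

variable {V : Type*} [AddCommGroup V] [Module ℝ V]

theorem QuadraticMap.map_smul_add_smul (f : QuadraticForm ℝ V) (u v : ℝ) (x y : V) :
    f (u • x + v • y) = u ^ 2 * f x + v ^ 2 * f y + u * v * QuadraticMap.polar f x y := by
  rw [QuadraticMap.map_add f, QuadraticMap.map_smul, QuadraticMap.map_smul,
    QuadraticMap.polar_smul_left, QuadraticMap.polar_smul_right]
  simp only [smul_eq_mul]
  ring

/-- If a positive convex combination of `f` and `g` is positive at `x` and at `y`, where `f` is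
positive at `x` and `g` is positive at `y`, then `f` and `g` are both positive at some common
vector. -/
theorem QuadraticMap.exists_pos_and_pos (f g : QuadraticForm ℝ V) {t : ℝ} (ht : t ∈ Icc (0 : ℝ) 1)
    {x y : V} (hfx : 0 < f x) (hgy : 0 < g y) (hx : 0 < t * f x + (1 - t) * g x)
    (hy : 0 < t * f y + (1 - t) * g y) : ∃ z, 0 < f z ∧ 0 < g z := by
  -- Replacing `y` by `-y` changes the sign of the polar form of the combination.
  wlog hp : 0 ≤ t * QuadraticMap.polar f x y + (1 - t) * QuadraticMap.polar g x y
    generalizing y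
  · refine this (y := -y) (by simpa using hgy) (by simpa using hy) ?_
    rw [QuadraticMap.polar_neg_right, QuadraticMap.polar_neg_right]
    linarith
  -- The combination is then positive on the segment `[x, y]`, so this segment is covered by the
  -- open sets where `f`, respectively `g`, is positive.
  have hcont (q : QuadraticForm ℝ V) : Continuous fun u : ℝ ↦ q ((1 - u) • x + u • y) := by
    simp only [QuadraticMap.map_smul_add_smul]
    fun_prop
  obtain ⟨u, -, hfu, hgu⟩ := isPreconnected_Icc (a := (0 : ℝ)) (b := 1)
    {u | 0 < f ((1 - u) • x + u • y)} {u | 0 < g ((1 - u) • x + u • y)}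
    (isOpen_lt continuous_const (hcont f)) (isOpen_lt continuous_const (hcont g))
    (by
      intro u hu
      have hpos : 0 < t * f ((1 - u) • x + u • y) + (1 - t) * g ((1 - u) • x + u • y) := by
        rw [QuadraticMap.map_smul_add_smul, QuadraticMap.map_smul_add_smul]
        have h1 : 0 ≤ (1 - u) * u := mul_nonneg (by linarith [hu.2]) hu.1
        have h2 : 0 < (1 - u) ^ 2 * (t * f x + (1 - t) * g x)
            + u ^ 2 * (t * f y + (1 - t) * g y) := by
          rcases hu.1.eq_or_lt with rfl | h0
          · simpa using hx
          · exact add_pos_of_nonneg_of_pos (mul_nonneg (sq_nonneg _) hx.le)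
              (mul_pos (pow_pos h0 2) hy)
        linarith [mul_nonneg h1 hp]
      by_contra hcon
      simp only [mem_union, mem_ofPred_eq, not_or, not_lt] at hcon
      linarith [mul_nonpos_of_nonneg_of_nonpos ht.1 hcon.1,
        mul_nonpos_of_nonneg_of_nonpos (sub_nonneg.2 ht.2) hcon.2])
    ⟨0, by simp, by simpa using hfx⟩ ⟨1, by simp, by simpa using hgy⟩
  exact ⟨_, hfu, hgu⟩

/-- **Yuan's lemma**: if two quadratic forms on a real vector space are never positive at the same
vector, then some convex combination of them is nowhere positive. -/
theorem QuadraticMap.exists_convexCombination_nonpos (f g : QuadraticForm ℝ V)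
    (h : ∀ x, 0 < f x → g x ≤ 0) :
    ∃ t ∈ Icc (0 : ℝ) 1, ∀ x, t * f x + (1 - t) * g x ≤ 0 := by
  by_contra! hcon
  have hopen (x : V) : IsOpen {t : ℝ | 0 < t * f x + (1 - t) * g x} :=
    isOpen_lt continuous_const (by fun_prop)
  -- Every `t` admits a vector at which the combination is positive, and there either `f` or `g`
  -- is positive; both cases define open sets of parameters, so they occur for a common `t`.
  obtain ⟨t, ht, htf, htg⟩ := isPreconnected_Icc (a := (0 : ℝ)) (b := 1)
    (⋃ x ∈ {x | 0 < f x}, {t : ℝ | 0 < t * f x + (1 - t) * g x})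
    (⋃ x ∈ {x | 0 < g x}, {t : ℝ | 0 < t * f x + (1 - t) * g x})
    (isOpen_biUnion fun x _ ↦ hopen x) (isOpen_biUnion fun x _ ↦ hopen x)
    (by
      intro t ht
      obtain ⟨x, hx⟩ := hcon t ht
      rcases lt_or_ge 0 (f x) with hf | hf
      · exact Or.inl (mem_biUnion (x := x) hf hx)
      · refine Or.inr (mem_biUnion (x := x) ?_ hx)
        refine pos_of_mul_pos_right ?_ (sub_nonneg.2 ht.2)
        linarith [mul_nonpos_of_nonneg_of_nonpos ht.1 hf])
    (by
      obtain ⟨x, hx⟩ := hcon 1 (by simp)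
      exact ⟨1, by simp, mem_biUnion (x := x) (by simpa using hx) hx⟩)
    (by
      obtain ⟨x, hx⟩ := hcon 0 (by simp)
      exact ⟨0, by simp, mem_biUnion (x := x) (by simpa using hx) hx⟩)
  simp only [mem_iUnion, mem_ofPred_eq, exists_prop] at htf htg
  obtain ⟨x, hfx, hx⟩ := htf
  obtain ⟨y, hgy, hy⟩ := htg
  obtain ⟨z, hfz, hgz⟩ := QuadraticMap.exists_pos_and_pos f g ht hfx hgy hx hy
  exact (h z hfz).not_gt hgz

end Yuan

/-! ### Multipliers for two ellipsoidal constraints -/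

section Multipliers

variable {V E E' Z : Type*} [AddCommGroup V] [Module ℝ V]
  [NormedAddCommGroup E] [InnerProductSpace ℝ E]
  [NormedAddCommGroup E'] [InnerProductSpace ℝ E']
  [NormedAddCommGroup Z] [InnerProductSpace ℝ Z]

/-- The quadratic form `x ↦ ‖T x‖²` of a linear map into an inner product space. -/
noncomputable def normSqForm (T : V →ₗ[ℝ] E) : QuadraticForm ℝ V :=
  (LinearMap.BilinMap.toQuadraticMap (innerₗ E)).comp T

theorem normSqForm_apply (T : V →ₗ[ℝ] E) (x : V) : normSqForm T x = ‖T x‖ ^ 2 :=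
  real_inner_self_eq_norm_sq (T x)

theorem norm_sq_map_inv_sqrt_smul (T : V →ₗ[ℝ] E) {d : ℝ} (hd : 0 < d) (x : V) :
    ‖T ((√d)⁻¹ • x)‖ ^ 2 = ‖T x‖ ^ 2 / d := by
  rw [map_smul, norm_smul, mul_pow, norm_inv, inv_pow, Real.norm_eq_abs, sq_abs,
    Real.sq_sqrt hd.le, inv_mul_eq_div]

/-- A bound for `‖Q x‖²` on the set `‖R x‖² ≤ 1`, `‖S x‖² ≤ 1` extends to all vectors by
homogeneity. -/
theorem norm_sq_le_mul_max (R : V →ₗ[ℝ] E) (S : V →ₗ[ℝ] E') (Q : V →ₗ[ℝ] Z) {c : ℝ} (hc : 0 ≤ c)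
    (h : ∀ x, ‖R x‖ ^ 2 ≤ 1 → ‖S x‖ ^ 2 ≤ 1 → ‖Q x‖ ^ 2 ≤ c) (x : V) :
    ‖Q x‖ ^ 2 ≤ c * max (‖R x‖ ^ 2) (‖S x‖ ^ 2) := by
  by_contra! hlt
  have hq : 0 < ‖Q x‖ ^ 2 :=
    (mul_nonneg hc (le_max_of_le_left (sq_nonneg _))).trans_lt hlt
  -- The second term keeps the scaling factor finite when `R x = 0` and `S x = 0`.
  set d : ℝ := max (max (‖R x‖ ^ 2) (‖S x‖ ^ 2)) (‖Q x‖ ^ 2 / (c + 1)) with hd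
  have hd0 : 0 < d := lt_max_of_lt_right (by positivity)
  have hcd : c * d < ‖Q x‖ ^ 2 := by
    rw [hd, mul_max_of_nonneg _ _ hc]
    refine max_lt hlt ?_
    rw [mul_div_assoc', div_lt_iff₀ (by linarith)]
    linarith
  have hR : ‖R ((√d)⁻¹ • x)‖ ^ 2 ≤ 1 := by
    rw [norm_sq_map_inv_sqrt_smul _ hd0, div_le_one hd0]
    exact le_max_of_le_left (le_max_left _ _)
  have hS : ‖S ((√d)⁻¹ • x)‖ ^ 2 ≤ 1 := by
    rw [norm_sq_map_inv_sqrt_smul _ hd0, div_le_one hd0]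
    exact le_max_of_le_left (le_max_right _ _)
  have hQ := h _ hR hS
  rw [norm_sq_map_inv_sqrt_smul _ hd0, div_le_iff₀ hd0] at hQ
  exact hQ.not_gt hcd

/-- Lossless S-procedure for two homogeneous quadratic constraints: an upper bound `c` for the
constrained maximum splits as `c = a + b` with `a`, `b` multipliers of the two constraints. -/
theorem exists_multipliers (R : V →ₗ[ℝ] E) (S : V →ₗ[ℝ] E') (Q : V →ₗ[ℝ] Z) {c : ℝ} (hc : 0 ≤ c)
    (h : ∀ x, ‖R x‖ ^ 2 ≤ 1 → ‖S x‖ ^ 2 ≤ 1 → ‖Q x‖ ^ 2 ≤ c) :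
    ∃ a b : ℝ, 0 ≤ a ∧ 0 ≤ b ∧ a + b = c ∧
      ∀ x, ‖Q x‖ ^ 2 ≤ a * ‖R x‖ ^ 2 + b * ‖S x‖ ^ 2 := by
  obtain ⟨t, ht, hle⟩ := QuadraticMap.exists_convexCombination_nonpos
    (normSqForm Q - c • normSqForm R) (normSqForm Q - c • normSqForm S) (by
      intro x hx
      have hmax := norm_sq_le_mul_max R S Q hc h x
      simp only [sub_apply, smul_apply, normSqForm_apply,
        smul_eq_mul] at hx ⊢
      rw [mul_max_of_nonneg _ _ hc, le_max_iff] at hmax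
      rcases hmax with hmax | hmax <;> linarith)
  refine ⟨t * c, (1 - t) * c, mul_nonneg ht.1 hc, mul_nonneg (sub_nonneg.2 ht.2) hc, by ring,
    fun x ↦ ?_⟩
  have hx := hle x
  simp only [sub_apply, smul_apply, normSqForm_apply,
    smul_eq_mul] at hx
  linarith

end Multipliers

/-! ### Positive operators and the dual constraint -/

theorem ContinuousLinearMap.IsPositive.apply_eq_zero_of_inner_eq_zero {V : Type*}
    [NormedAddCommGroup V] [InnerProductSpace ℝ V] {T : V →L[ℝ] V} (hT : T.IsPositive) {x : V}
    (hx : ⟪T x, x⟫_ℝ = 0) : T x = 0 := by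
  -- The quadratic polynomial `s ↦ ⟪T (x + s • T x), x + s • T x⟫` is nonnegative and has no
  -- constant term, so its linear coefficient `2 ‖T x‖²` vanishes.
  have hpoly (s : ℝ) : 0 ≤ ⟪T (T x), T x⟫_ℝ * (s * s) + 2 * ‖T x‖ ^ 2 * s + 0 := by
    have hs := hT.inner_nonneg_left (x + s • T x)
    have hsymm : ⟪T (T x), x⟫_ℝ = ‖T x‖ ^ 2 := by
      rw [hT.inner_left_eq_inner_right, real_inner_self_eq_norm_sq]
    rw [map_add, map_smul, inner_add_left, inner_add_right, inner_add_right, inner_smul_left,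
      inner_smul_left, inner_smul_right, inner_smul_right, hx, hsymm,
      real_inner_self_eq_norm_sq] at hs
    simp only [conj_trivial] at hs
    linarith
  have hdisc := discrim_le_zero hpoly
  rw [discrim, mul_zero, sub_zero] at hdisc
  simpa using pow_eq_zero_iff two_ne_zero |>.1 (le_antisymm hdisc (sq_nonneg _))

namespace TwoEllipsoid

variable {H Y E E' Z : Type*}
  [NormedAddCommGroup H] [InnerProductSpace ℝ H] [CompleteSpace H]
  [NormedAddCommGroup Y] [InnerProductSpace ℝ Y]
  [NormedAddCommGroup E] [InnerProductSpace ℝ E] [CompleteSpace E]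
  [NormedAddCommGroup E'] [InnerProductSpace ℝ E'] [CompleteSpace E']
  [NormedAddCommGroup Z] [InnerProductSpace ℝ Z] [CompleteSpace Z]

theorem inner_gramNull_self (L : H →L[ℝ] Y) (T : H →L[ℝ] E) (x : nullSpace L) :
    ⟪gramNull L T x, x⟫_ℝ = ‖T x‖ ^ 2 := by
  rw [gramNull, ContinuousLinearMap.comp_apply, ContinuousLinearMap.adjoint_inner_left,
    real_inner_self_eq_norm_sq]
  rfl

theorem gramNull_isSymmetric (L : H →L[ℝ] Y) (T : H →L[ℝ] E) :
    (gramNull L T : nullSpace L →ₗ[ℝ] nullSpace L).IsSymmetric :=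
  (ContinuousLinearMap.isPositive_adjoint_comp_self (restrictNull L T)).isSymmetric

theorem inner_slack_self (L : H →L[ℝ] Y) (R : H →L[ℝ] E) (S : H →L[ℝ] E') (Q : H →L[ℝ] Z)
    (a b : ℝ) (x : nullSpace L) :
    ⟪(a • gramNull L R + b • gramNull L S - gramNull L Q) x, x⟫_ℝ =
      a * ‖R x‖ ^ 2 + b * ‖S x‖ ^ 2 - ‖Q x‖ ^ 2 := by
  simp only [sub_apply, add_apply,
    smul_apply, inner_sub_left, inner_add_left, real_inner_smul_left,
    inner_gramNull_self]

theorem gramNull_le_iff (L : H →L[ℝ] Y) (R : H →L[ℝ] E) (S : H →L[ℝ] E') (Q : H →L[ℝ] Z)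
    (a b : ℝ) : gramNull L Q ≤ a • gramNull L R + b • gramNull L S ↔
      ∀ x : nullSpace L, ‖Q x‖ ^ 2 ≤ a * ‖R x‖ ^ 2 + b * ‖S x‖ ^ 2 := by
  rw [ContinuousLinearMap.le_def, ContinuousLinearMap.isPositive_iff]
  simp only [inner_slack_self, sub_nonneg]
  refine and_iff_right ?_
  intro x y
  have hR := gramNull_isSymmetric L R x y
  have hS := gramNull_isSymmetric L S x y
  have hQ := gramNull_isSymmetric L Q x y
  simp only [ContinuousLinearMap.coe_coe] at hR hS hQ ⊢
  simp only [sub_apply, add_apply,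
    smul_apply, inner_sub_left, inner_add_left, real_inner_smul_left,
    inner_sub_right, inner_add_right, real_inner_smul_right, hR, hS, hQ]

/-! ### Duality -/

theorem norm_sq_le_of_mem_dualFeasible {L : H →L[ℝ] Y} {R : H →L[ℝ] E} {S : H →L[ℝ] E'}
    {Q : H →L[ℝ] Z} {h : nullSpace L} (hh : h ∈ primalFeasible L R S) {p : ℝ × ℝ}
    (hp : p ∈ dualFeasible L R S Q) : ‖Q h‖ ^ 2 ≤ p.1 + p.2 := by
  obtain ⟨ha, hb, hle⟩ := hp
  have h1 := (gramNull_le_iff L R S Q _ _).1 hle h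
  linarith [mul_le_mul_of_nonneg_left hh.1 ha, mul_le_mul_of_nonneg_left hh.2 hb]

theorem exists_mem_dualFeasible {L : H →L[ℝ] Y} {R : H →L[ℝ] E} {S : H →L[ℝ] E'}
    {Q : H →L[ℝ] Z} {c : ℝ} (h : ∀ x ∈ primalFeasible L R S, ‖Q x‖ ^ 2 ≤ c) :
    ∃ p ∈ dualFeasible L R S Q, p.1 + p.2 = c := by
  have hc : 0 ≤ c := by simpa using h 0 (by simp [primalFeasible])
  obtain ⟨a, b, ha, hb, hab, hle⟩ := exists_multipliers
    (restrictNull L R : nullSpace L →ₗ[ℝ] E) (restrictNull L S : nullSpace L →ₗ[ℝ] E')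
    (restrictNull L Q : nullSpace L →ₗ[ℝ] Z) hc fun x hR hS ↦ h x ⟨hR, hS⟩
  exact ⟨(a, b), ⟨ha, hb, (gramNull_le_iff L R S Q a b).2 hle⟩, hab⟩

theorem iSup_primal_eq_iInf_dual (L : H →L[ℝ] Y) (R : H →L[ℝ] E) (S : H →L[ℝ] E')
    (Q : H →L[ℝ] Z) :
    (⨆ h ∈ primalFeasible L R S, ((‖Q h‖ ^ 2 : ℝ) : EReal)) =
      ⨅ p ∈ dualFeasible L R S Q, ((p.1 + p.2 : ℝ) : EReal) := by
  refine le_antisymm (iSup₂_le fun h hh ↦ le_iInf₂ fun p hp ↦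
    EReal.coe_le_coe_iff.2 (norm_sq_le_of_mem_dualFeasible hh hp)) ?_
  set s := ⨆ h ∈ primalFeasible L R S, ((‖Q h‖ ^ 2 : ℝ) : EReal) with hs
  have hle (h : nullSpace L) (hh : h ∈ primalFeasible L R S) : ((‖Q h‖ ^ 2 : ℝ) : EReal) ≤ s :=
    le_iSup₂_of_le h hh le_rfl
  -- The supremum is not `⊥`, since `0` is feasible.
  have hbot : s ≠ ⊥ := fun h0 ↦
    EReal.coe_ne_bot _ (le_bot_iff.1 (h0 ▸ hle 0 (by simp [primalFeasible])))
  clear_value s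
  induction s with
  | bot => exact absurd rfl hbot
  | top => exact le_top
  | coe c =>
    obtain ⟨p, hp, hpc⟩ := exists_mem_dualFeasible (Q := Q) fun x hx ↦
      EReal.coe_le_coe_iff.1 (hle x hx)
    exact iInf₂_le_of_le p hp (by rw [hpc])

theorem optimality_conditions {L : H →L[ℝ] Y} {R : H →L[ℝ] E} {S : H →L[ℝ] E'}
    {Q : H →L[ℝ] Z} {h : nullSpace L} {a b : ℝ} (hh : h ∈ primalFeasible L R S)
    (hmax : IsMaxOn (fun x : nullSpace L ↦ ‖Q x‖ ^ 2) (primalFeasible L R S) h)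
    (ha : 0 < a) (hb : 0 < b) (hab : (a, b) ∈ dualFeasible L R S Q)
    (hmin : IsMinOn (fun p : ℝ × ℝ ↦ p.1 + p.2) (dualFeasible L R S Q) (a, b)) :
    (‖R h‖ = 1 ∧ ‖S h‖ = 1) ∧
      (a • gramNull L R + b • gramNull L S) h = gramNull L Q h := by
  have hval : a + b ≤ ‖Q h‖ ^ 2 := by
    obtain ⟨p, hp, hpc⟩ := exists_mem_dualFeasible fun x hx ↦ hmax hx
    exact (hmin hp).trans_eq hpc
  have hslack := (gramNull_le_iff L R S Q a b).1 hab.2.2 h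
  have hR := mul_le_mul_of_nonneg_left hh.1 ha.le
  have hS := mul_le_mul_of_nonneg_left hh.2 hb.le
  have hR1 : ‖R h‖ ^ 2 = 1 := mul_left_cancel₀ ha.ne' (by linarith)
  have hS1 : ‖S h‖ ^ 2 = 1 := mul_left_cancel₀ hb.ne' (by linarith)
  refine ⟨⟨(pow_eq_one_iff_of_nonneg (norm_nonneg _) two_ne_zero).1 hR1,
    (pow_eq_one_iff_of_nonneg (norm_nonneg _) two_ne_zero).1 hS1⟩, sub_eq_zero.1 ?_⟩
  rw [← sub_apply]
  refine ((ContinuousLinearMap.le_def _ _).1 hab.2.2).apply_eq_zero_of_inner_eq_zero ?_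
  rw [inner_slack_self]
  linarith

end TwoEllipsoid


theorem mainTheorem7 {H E E' Z : Type*}
    [NormedAddCommGroup H] [InnerProductSpace ℝ H] [CompleteSpace H]
    [NormedAddCommGroup E] [InnerProductSpace ℝ E] [CompleteSpace E]
    [NormedAddCommGroup E'] [InnerProductSpace ℝ E'] [CompleteSpace E']
    [NormedAddCommGroup Z] [InnerProductSpace ℝ Z] [CompleteSpace Z]
    (m : ℕ) (L : H →L[ℝ] EuclideanSpace ℝ (Fin m)) (hL : Function.Surjective L)
    (R : H →L[ℝ] E) (S : H →L[ℝ] E') (Q : H →L[ℝ] Z)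
    (hker : ∀ h : H, R h = 0 → S h = 0 → L h = 0 → h = 0) :
    (⨆ h ∈ TwoEllipsoid.primalFeasible L R S, ((‖Q h‖ ^ 2 : ℝ) : EReal)) =
        (⨅ p ∈ TwoEllipsoid.dualFeasible L R S Q, ((p.1 + p.2 : ℝ) : EReal)) ∧
      ∀ (h : TwoEllipsoid.nullSpace L) (a b : ℝ),
        h ∈ TwoEllipsoid.primalFeasible L R S →
        IsMaxOn (fun x : TwoEllipsoid.nullSpace L => ‖Q x‖ ^ 2)
          (TwoEllipsoid.primalFeasible L R S) h →
        0 < a → 0 < b →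
        (a, b) ∈ TwoEllipsoid.dualFeasible L R S Q →
        IsMinOn (fun p : ℝ × ℝ => p.1 + p.2) (TwoEllipsoid.dualFeasible L R S Q) (a, b) →
        (‖R h‖ = 1 ∧ ‖S h‖ = 1) ∧
          (a • TwoEllipsoid.gramNull L R + b • TwoEllipsoid.gramNull L S) h =
            TwoEllipsoid.gramNull L Q h := by
  exact ⟨TwoEllipsoid.iSup_primal_eq_iInf_dual L R S Q, fun _ _ _ hh hmax ha hb hab hmin ↦
    TwoEllipsoid.optimality_conditions hh hmax ha hb hab hmin⟩
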